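/- Let $K$ be a field, $n\ge 1$ and $d\ge 2$ integers, $S=K[x_1,\dots,x_n]$, and let ${\bf t}=(t_1,\dots,t_{d-1})$ be a tuple of non-negative integers. A monomial $x_{j_1}x_{j_2}\cdots x_{j_\ell}$ of $S$ with $j_1\le j_2\le\dots\le j_\ell$ and $0\le \ell\le d$ is called ${\bf t}$-spread if $j_{i+1}-j_i\ge t_i$ for $i=1,\dots,\ell-1$. Let $M_{n,\ell,{\bf t}}$ be the set of ${\bf t}$-spread monomials of degree $\ell$ in $S$. For a monomial ideal $I\subseteq S$, let $[I_\ell]_{\bf t}$ be the set of ${\bf t}$-spread monomials of degree $\ell$ in $I$, and let the $f_{\bf t}$-vector of $I$ be $f_{\bf t}(I)=(f_{{\bf t},-1}(I),\dots,f_{{\bf t},d-1}(I))$, where $f_{{\bf t},\ell-1}(I)=|M_{n,\ell,{\bf t}}|-|[I_\ell]_{\bf t}|$ for $0\le\ell\le d$. A ${\bf t}$-spread strongly stable ideal is an ideal $I$ generated by a (possibly empty) set of ${\bf t}$-spread monomials such that, for all $\ell$, all $u\in[I_\ell]_{\bf t}$ and all $j<i$ such that $x_i$ divides $u$ and $x_j(u/x_i)$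 is ${\bf t}$-spread, one has $x_j(u/x_i)\in[I_\ell]_{\bf t}$. For $1\le\ell<d$ and a positive integer $a$ let $a=\sum_{j=p}^{\ell}\binom{a_j}{j}$, with $a_\ell>a_{\ell-1}>\dots>a_p\ge p\ge1$, be the unique binomial (Macaulay) expansion of $a$ with respect to $\ell$, and put $$a^{(n,\ell,{\bf t})}=\sum_{j=p+1}^{\ell+1}\binom{a_{j-1}+1-t_\ell}{j},$$ where $\binom{m}{j}=0$ for all integers $m<j$ (in particular for $m<0$). Put also $0^{(n,\ell,{\bf t})}=0$ for $0\le\ell<d$ and, for $\ell=0$, $1^{(n,0,{\bf t})}=n=|M_{n,1,{\bf t}}|$. **Theorem.** Let $f=(f_{-1},f_0,\dots,f_{d-1})$ be a sequence of non-negative integers. The following conditions are equivalent: (i) there exists a ${\bf t}$-spread strongly stable ideal $I\subsetneq S$ with $f_{\bf t}(I)=f$; (ii) $f_{-1}=1$ and $f_{\ell+1}\le f_\ell^{(n,\ell+1,{\bf t})}$ for all $\ell=-1,\dots,d-2$. -/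

import Mathlib

namespace VectorSpread

/-- The monomial with exponent vector `u` in the variables `x_1, …, x_n` (indexed by `Fin n`) is
`t`-spread, for `t = (t_1, …, t_{d-1})`: it is `x_{j_1} ⋯ x_{j_ℓ}` with `ℓ ≤ d`,
`j_1 ≤ ⋯ ≤ j_ℓ` and `j_{i+1} - j_i ≥ t_i` for `i = 1, …, ℓ - 1`. All indices are shifted down
by one. -/
def IsSpread {n d : ℕ} (t : Fin (d - 1) → ℕ) (u : Fin n →₀ ℕ) : Prop :=
  ∃ ℓ : ℕ, ℓ ≤ d ∧ ∃ j : Fin ℓ → Fin n, Monotone j ∧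
    u = ∑ i, Finsupp.single (j i) 1 ∧
    ∀ (i : Fin (d - 1)) (h : (i : ℕ) + 1 < ℓ),
      (j ⟨i, Nat.lt_of_succ_lt h⟩ : ℕ) + t i ≤ (j ⟨(i : ℕ) + 1, h⟩ : ℕ)

/-- `M_{n,ℓ,t}`: the set of `t`-spread monomials of degree `ℓ`, as exponent vectors. -/
def spreadMonomials (n : ℕ) {d : ℕ} (t : Fin (d - 1) → ℕ) (ℓ : ℕ) : Set (Fin n →₀ ℕ) :=
  {u | IsSpread t u ∧ u.degree = ℓ}

/-- A `t`-spread monomial ideal: an ideal generated by a set (possibly empty) of `t`-spread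
monomials. -/
def IsSpreadIdeal {n d : ℕ} {K : Type*} [Field K] (t : Fin (d - 1) → ℕ)
    (I : Ideal (MvPolynomial (Fin n) K)) : Prop :=
  ∃ A : Set (Fin n →₀ ℕ), (∀ u ∈ A, IsSpread t u) ∧
    I = Ideal.span ((fun u => MvPolynomial.monomial u (1 : K)) '' A)

/-- `[I_ℓ]_t`: the set of `t`-spread monomials of degree `ℓ` that belong to `I`. -/
def spreadPart {n d : ℕ} {K : Type*} [Field K] (t : Fin (d - 1) → ℕ)
    (I : Ideal (MvPolynomial (Fin n) K)) (ℓ : ℕ) : Set (Fin n →₀ ℕ) :=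
  {u | u ∈ spreadMonomials n t ℓ ∧ MvPolynomial.monomial u (1 : K) ∈ I}

/-- A `t`-spread strongly stable set: if `u ∈ L`, `j < i`, `x_i` divides `u` and `x_j (u / x_i)`
is `t`-spread, then `x_j (u / x_i) ∈ L`. -/
def IsStronglyStableSet {n d : ℕ} (t : Fin (d - 1) → ℕ) (L : Set (Fin n →₀ ℕ)) : Prop :=
  ∀ u ∈ L, ∀ i j : Fin n, j < i → u i ≠ 0 →
    IsSpread t (u - Finsupp.single i 1 + Finsupp.single j 1) →
      u - Finsupp.single i 1 + Finsupp.single j 1 ∈ L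

/-- A `t`-spread strongly stable ideal. -/
def IsStronglyStableIdeal {n d : ℕ} {K : Type*} [Field K] (t : Fin (d - 1) → ℕ)
    (I : Ideal (MvPolynomial (Fin n) K)) : Prop :=
  IsSpreadIdeal t I ∧ ∀ ℓ : ℕ, IsStronglyStableSet t (spreadPart t I ℓ)

theorem finite_spreadMonomials (n : ℕ) {d : ℕ} (t : Fin (d - 1) → ℕ) (ℓ : ℕ) :
    (spreadMonomials n t ℓ).Finite := by
  refine (Finsupp.finite_of_degree_le (σ := Fin n) ℓ).subset ?_
  rintro u ⟨-, hu⟩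
  exact hu.le

/-- The subtraction in the definition of the `f_t`-vector is never truncated. -/
theorem ncard_spreadPart_le {n d : ℕ} {K : Type*} [Field K] (t : Fin (d - 1) → ℕ)
    (I : Ideal (MvPolynomial (Fin n) K)) (ℓ : ℕ) :
    (spreadPart t I ℓ).ncard ≤ (spreadMonomials n t ℓ).ncard :=
  Set.ncard_le_ncard (fun _ hu => hu.1) (finite_spreadMonomials n t ℓ)

/-- The `f_t`-vector `(f_{t,-1}(I), f_{t,0}(I), …, f_{t,d-1}(I))` of `I`. The entry with index
`ℓ : Fin (d + 1)` is `f_{t,ℓ-1}(I) = |M_{n,ℓ,t}| - |[I_ℓ]_t|`. -/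
noncomputable def fVector {n d : ℕ} {K : Type*} [Field K] (t : Fin (d - 1) → ℕ)
    (I : Ideal (MvPolynomial (Fin n) K)) : Fin (d + 1) → ℕ :=
  fun ℓ => (spreadMonomials n t ℓ).ncard - (spreadPart t I ℓ).ncard

/-- `a = ∑_{j=p}^{ℓ} (c_j choose j)` with `c_ℓ > ⋯ > c_p ≥ p ≥ 1` is the binomial (Macaulay)
expansion of `a` with respect to `ℓ`. -/
def IsBinomialExpansion (ℓ a p : ℕ) (c : ℕ → ℕ) : Prop :=
  1 ≤ p ∧ p ≤ ℓ ∧ p ≤ c p ∧ StrictMonoOn c (Set.Icc p ℓ) ∧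
    a = ∑ j ∈ Finset.Icc p ℓ, (c j).choose j

open Classical in
/-- For the binomial expansion `a = ∑_{j=p}^{ℓ} (c_j choose j)` of a positive integer `a` with
respect to `ℓ ≥ 1`, the number `∑_{j=p+1}^{ℓ+1} (c_{j-1} + 1 - s choose j)`; the value at `a = 0`,
which has no expansion (the empty sum), is `0`. A binomial coefficient with negative upper entry
is `0`; since `j ≥ 2` in this sum, the truncated subtraction gives the same value. -/
noncomputable def expansionShift (ℓ s a : ℕ) : ℕ :=
  if h : ∃ e : ℕ × (ℕ → ℕ), IsBinomialExpansion ℓ a e.1 e.2 then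
    ∑ j ∈ Finset.Icc (h.choose.1 + 1) (ℓ + 1), (h.choose.2 (j - 1) + 1 - s).choose j
  else 0

/-- The `t`-spread operator `a ↦ a^{(n,ℓ,t)}` for `0 ≤ ℓ < d`. For `1 ≤ ℓ` it is
`∑_{j=p+1}^{ℓ+1} (a_{j-1} + 1 - t_ℓ choose j)` in terms of the binomial expansion of `a` with
respect to `ℓ`. For `ℓ = 0`, where `a ≤ |M_{n,0,t}| = 1`, it sends `1` to `|M_{n,1,t}| = n` and
`0` to `0`. -/
noncomputable def spreadOp (n : ℕ) {d : ℕ} (t : Fin (d - 1) → ℕ) (ℓ : Fin d) (a : ℕ) : ℕ :=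
  if h : (ℓ : ℕ) = 0 then (if a = 0 then 0 else n)
  else expansionShift ℓ (t ⟨(ℓ : ℕ) - 1, by omega⟩) a

theorem IsBinomialExpansion.lt_choose {ℓ a p : ℕ} {c : ℕ → ℕ}
    (h : IsBinomialExpansion ℓ a p c) : a < (c ℓ + 1).choose ℓ := by
  induction ℓ generalizing a with
  | zero => obtain ⟨h1, h2, -⟩ := h; omega
  | succ ℓ ih =>
    obtain ⟨h1, h2, h3, h4, rfl⟩ := h
    have hs := Nat.choose_succ_succ' (c (ℓ + 1)) ℓ
    rcases h2.eq_or_lt with rfl | h2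
    · simp only [Finset.Icc_self, Finset.sum_singleton]
      have := Nat.choose_pos (n := c (ℓ + 1)) (k := ℓ) (by omega)
      omega
    · have h2' : p ≤ ℓ := by omega
      have hm : StrictMonoOn c (Set.Icc p ℓ) := h4.mono (Set.Icc_subset_Icc_right (by omega))
      have := ih ⟨h1, h2', h3, hm, rfl⟩
      have hlt : c ℓ < c (ℓ + 1) := h4 ⟨h2', by omega⟩ ⟨by omega, le_rfl⟩ (by omega)
      have := Nat.choose_le_choose ℓ (show c ℓ + 1 ≤ c (ℓ + 1) by omega)
      rw [Finset.sum_Icc_succ_top (by omega)]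
      omega

/-- Every positive integer has a binomial expansion with respect to every `ℓ ≥ 1`. -/
theorem exists_isBinomialExpansion {ℓ a : ℕ} (hℓ : 1 ≤ ℓ) (ha : 1 ≤ a) :
    ∃ p c, IsBinomialExpansion ℓ a p c := by
  induction ℓ, hℓ using Nat.le_induction generalizing a with
  | base =>
    refine ⟨1, fun _ => a, le_rfl, le_rfl, ha, ?_, by simp⟩
    rintro x ⟨hx1, hx2⟩ y ⟨hy1, hy2⟩ hxy
    omega
  | succ ℓ hℓ ih =>
    have hex : ∃ m, a < (m + 1).choose (ℓ + 1) := by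
      refine ⟨a + ℓ, ?_⟩
      clear ha
      induction a with
      | zero => simp
      | succ a iha =>
        have h1 := Nat.choose_succ_succ' (a + 1 + ℓ) ℓ
        have h2 := Nat.choose_pos (n := a + 1 + ℓ) (k := ℓ) (by omega)
        rw [show a + 1 + ℓ = a + ℓ + 1 by omega] at *
        omega
    obtain ⟨m, hm1, hm2⟩ : ∃ m, a < (m + 1).choose (ℓ + 1) ∧ m.choose (ℓ + 1) ≤ a := by
      refine ⟨Nat.find hex, Nat.find_spec hex, ?_⟩
      rcases h : Nat.find hex with _ | k
      · simp
      · exact not_lt.1 (Nat.find_min hex (m := k) (by omega))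
    have hmℓ : ℓ + 1 ≤ m := by
      by_contra hc
      have := Nat.choose_le_choose (ℓ + 1) (show m + 1 ≤ ℓ + 1 by omega)
      rw [Nat.choose_self] at this
      omega
    rcases hm2.eq_or_lt with heq | hlt
    · refine ⟨ℓ + 1, fun _ => m, by omega, le_rfl, hmℓ, ?_, by simp [heq]⟩
      rintro x ⟨hx1, hx2⟩ y ⟨hy1, hy2⟩ hxy
      omega
    · obtain ⟨p, c, hc⟩ := ih (a := a - m.choose (ℓ + 1)) (by omega)
      have hs := Nat.choose_succ_succ' m ℓ
      obtain ⟨h1, h2, h3, h4, h5⟩ := hc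
      have hcm : c ℓ < m := by
        by_contra hge
        have e1 := Nat.choose_le_choose ℓ (not_lt.1 hge)
        have e2 := Finset.single_le_sum (f := fun j => (c j).choose j)
          (fun _ _ => Nat.zero_le _) (Finset.mem_Icc.2 ⟨h2, le_rfl⟩)
        omega
      refine ⟨p, fun j => if j = ℓ + 1 then m else c j, h1, by omega, ?_, ?_, ?_⟩
      · change p ≤ if p = ℓ + 1 then m else c p
        rw [if_neg (by omega)]
        exact h3
      · rintro x ⟨hx1, hx2⟩ y ⟨hy1, hy2⟩ hxy
        have hx : x ≠ ℓ + 1 := by omega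
        simp only [if_neg hx]
        split_ifs with hy
        · exact lt_of_le_of_lt
            (h4.monotoneOn ⟨hx1, by omega⟩ ⟨h2, le_rfl⟩ (by omega)) hcm
        · exact h4 ⟨hx1, by omega⟩ ⟨hy1, by omega⟩ hxy
      · rw [Finset.sum_Icc_succ_top (by omega)]
        simp only [if_true]
        have : ∑ j ∈ Finset.Icc p ℓ, (if j = ℓ + 1 then m else c j).choose j =
            ∑ j ∈ Finset.Icc p ℓ, (c j).choose j := by
          refine Finset.sum_congr rfl fun j hj => ?_
          rw [Finset.mem_Icc] at hj
          rw [if_neg (by omega)]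
        rw [this]
        omega

/-- The binomial expansion is unique. -/
theorem IsBinomialExpansion.unique {ℓ a p p' : ℕ} {c c' : ℕ → ℕ}
    (h : IsBinomialExpansion ℓ a p c) (h' : IsBinomialExpansion ℓ a p' c') :
    p = p' ∧ ∀ j ∈ Set.Icc p ℓ, c j = c' j := by
  have key : ∀ {ℓ a p : ℕ} {c : ℕ → ℕ}, IsBinomialExpansion ℓ a p c → (c ℓ).choose ℓ ≤ a := by
    rintro ℓ a p c ⟨h1, h2, h3, h4, rfl⟩
    exact Finset.single_le_sum (f := fun j => (c j).choose j)
      (fun _ _ => Nat.zero_le _) (Finset.mem_Icc.2 ⟨h2, le_rfl⟩)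
  have top : ∀ {ℓ a p p' : ℕ} {c c' : ℕ → ℕ}, IsBinomialExpansion ℓ a p c →
      IsBinomialExpansion ℓ a p' c' → c ℓ ≤ c' ℓ := by
    intro ℓ a p p' c c' h h'
    by_contra hlt
    have e1 := key h
    have e2 := h'.lt_choose
    have e3 := Nat.choose_le_choose ℓ (show c' ℓ + 1 ≤ c ℓ by omega)
    omega
  have pos : ∀ {ℓ p : ℕ} {c : ℕ → ℕ}, IsBinomialExpansion ℓ 0 p c → False := by
    rintro ℓ p c ⟨h1, h2, h3, h4, h5⟩
    have e1 := (Finset.sum_eq_zero_iff.1 h5.symm) p (Finset.mem_Icc.2 ⟨le_rfl, h2⟩)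
    have e2 := Nat.choose_pos h3
    omega
  have low : ∀ {ℓ a p : ℕ} {c : ℕ → ℕ}, IsBinomialExpansion (ℓ + 1) a p c → p ≤ ℓ →
      IsBinomialExpansion ℓ (a - (c (ℓ + 1)).choose (ℓ + 1)) p c := by
    rintro ℓ a p c ⟨h1, h2, h3, h4, rfl⟩ hp
    refine ⟨h1, hp, h3, h4.mono (Set.Icc_subset_Icc_right (by omega)), ?_⟩
    rw [Finset.sum_Icc_succ_top (by omega)]
    omega
  have self : ∀ {ℓ a : ℕ} {c : ℕ → ℕ}, IsBinomialExpansion ℓ a ℓ c →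
      a - (c ℓ).choose ℓ = 0 := by
    rintro ℓ a c ⟨h1, h2, h3, h4, rfl⟩
    simp
  induction ℓ generalizing a with
  | zero => obtain ⟨h1, h2, -⟩ := h; omega
  | succ ℓ ih =>
    have htop := le_antisymm (top h h') (top h' h)
    have hp := h.2.1
    have hp' := h'.2.1
    rcases hp.eq_or_lt with rfl | hlt <;> rcases hp'.eq_or_lt with rfl | hlt'
    · refine ⟨rfl, fun j hj => ?_⟩
      obtain rfl : j = ℓ + 1 := le_antisymm hj.2 hj.1
      exact htop
    · have e1 := self h
      have e2 := low h' (by omega)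
      rw [← htop, e1] at e2
      exact (pos e2).elim
    · have e1 := self h'
      have e2 := low h (by omega)
      rw [htop, e1] at e2
      exact (pos e2).elim
    · have e1 := low h (by omega)
      have e2 := low h' (by omega)
      rw [← htop] at e2
      obtain ⟨r1, r2⟩ := ih e1 e2
      refine ⟨r1, fun j hj => ?_⟩
      rcases hj.2.eq_or_lt with rfl | hj2
      · exact htop
      · exact r2 j ⟨hj.1, by omega⟩

theorem expansionShift_eq {ℓ a p : ℕ} {c : ℕ → ℕ} (h : IsBinomialExpansion ℓ a p c) (s : ℕ) :
    expansionShift ℓ s a = ∑ j ∈ Finset.Icc (p + 1) (ℓ + 1), (c (j - 1) + 1 - s).choose j := by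
  have hex : ∃ e : ℕ × (ℕ → ℕ), IsBinomialExpansion ℓ a e.1 e.2 := ⟨(p, c), h⟩
  obtain ⟨hp, hc⟩ := h.unique hex.choose_spec
  rw [expansionShift, dif_pos hex, ← hp]
  refine Finset.sum_congr rfl fun j hj => ?_
  rw [Finset.mem_Icc] at hj
  rw [hc (j - 1) ⟨by omega, by omega⟩]

end VectorSpread

/-!
The spread monomials of degree `ℓ` are encoded by their index sequences `w 0 ≤ ⋯ ≤ w (ℓ - 1)`, whose
gaps are at least `τ 0, …, τ (ℓ - 2)`. Subtracting the required gaps and adding the position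
(`code`) turns them into the `ℓ`-element subsets of an initial segment of `ℕ`. A multiplication by a
variable that extends a sequence at its end adds a new largest element, and strong stability says
that the spread monomials outside the ideal form a family closed under raising elements.

*Necessity.* For a family of `ℓ`-sets closed under raising elements, the Kruskal–Katona inequality
(`IsUpShifted.sum_choose_lt_card`) bounds the number of members that avoid the top `m` points by
`∑ C(d j - m, j + 1)` as soon as the whole family has at most `∑ C(d j, j + 1)` members
(`IsUpShifted.card_filter_subset_range_le`). A spread monomial of degree `ℓ + 1` outside the ideal
consists of its initial part, again outside the ideal, and of its last index; the value of that
index decides how many top points the initial part avoids. Summing over the last index by the hockey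
stick identity gives the operator `expansionShift` (`card_le_expansionShift`).

*Sufficiency.* The spread sequences of length `ℓ` are numbered by `rank`, the combinatorial number
system, in which the binomial expansion of `a` is the sequence of rank `a`. The ideal is generated by
the spread monomials of rank at least `f ℓ` in degree `ℓ`. A sequence whose initial part has rank
`r` has rank at least `expansionShift` of `r`, and this operator is monotone
(`sum_shifted_cascade_mono`). So under the growth condition no further spread monomial is forced
into the ideal by generators of smaller degree (`monomial_mem_span_lexGenerators_iff`), and all ranks
below `f ℓ` occur (`exists_rank_eq`), so that exactly `f ℓ` spread monomials of degree `ℓ` stay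
outside the ideal.
-/

namespace VectorSpread

open Finset

/-! ### Kruskal–Katona for families closed under raising elements -/

/-- A family of finite sets of natural numbers is up-shifted below `N` if it is closed under
replacing an element of a member by a larger non-element below `N`. -/
def IsUpShifted (N : ℕ) (E : Finset (Finset ℕ)) : Prop :=
  ∀ A ∈ E, ∀ x ∈ A, ∀ y, y ∉ A → x < y → y < N → insert y (A.erase x) ∈ E

theorem IsUpShifted.nonMemberSubfamily {N : ℕ} {E : Finset (Finset ℕ)}
    (h : IsUpShifted (N + 1) E) : IsUpShifted N (E.nonMemberSubfamily N) := by
  intro A hA x hx y hy hxy hyN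
  rw [mem_nonMemberSubfamily] at hA ⊢
  refine ⟨h A hA.1 x hx y hy hxy (by omega), ?_⟩
  simp only [mem_insert, mem_erase, not_or, not_and]
  exact ⟨by omega, fun _ => hA.2⟩

theorem IsUpShifted.memberSubfamily {N : ℕ} {E : Finset (Finset ℕ)}
    (h : IsUpShifted (N + 1) E) : IsUpShifted N (E.memberSubfamily N) := by
  intro A hA x hx y hy hxy hyN
  rw [mem_memberSubfamily] at hA ⊢
  have hxN : x ≠ N := by omega
  have hyN' : y ≠ N := by omega
  refine ⟨?_, ?_⟩
  · have := h _ hA.1 x (mem_insert_of_mem hx) y (by simp [hyN', hy]) hxy (by omega)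
    rwa [erase_insert_of_ne hxN.symm, insert_comm] at this
  · simp only [mem_insert, mem_erase, not_or, not_and]
    exact ⟨by omega, fun _ => hA.2⟩

theorem nonMemberSubfamily_subset_powersetCard {N ℓ : ℕ} {E : Finset (Finset ℕ)}
    (h : E ⊆ powersetCard ℓ (range (N + 1))) :
    E.nonMemberSubfamily N ⊆ powersetCard ℓ (range N) := by
  intro A hA
  rw [mem_nonMemberSubfamily] at hA
  have hA' := mem_powersetCard.1 (h hA.1)
  rw [range_add_one, subset_insert_iff_of_notMem hA.2] at hA'
  exact mem_powersetCard.2 hA'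

theorem memberSubfamily_subset_powersetCard {N ℓ : ℕ} {E : Finset (Finset ℕ)}
    (h : E ⊆ powersetCard (ℓ + 1) (range (N + 1))) :
    E.memberSubfamily N ⊆ powersetCard ℓ (range N) := by
  intro A hA
  rw [mem_memberSubfamily] at hA
  have hA' := mem_powersetCard.1 (h hA.1)
  rw [card_insert_of_notMem hA.2, range_add_one] at hA'
  refine mem_powersetCard.2 ⟨?_, by omega⟩
  rw [← subset_insert_iff_of_notMem hA.2]
  exact (subset_insert _ _).trans hA'.1

/-- In an up-shifted family, the shadow of the members avoiding the top element `N` lies in the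
link of `N`. -/
theorem IsUpShifted.erase_mem_memberSubfamily {N ℓ : ℕ} {E : Finset (Finset ℕ)}
    (h : IsUpShifted (N + 1) E) (hE : E ⊆ powersetCard ℓ (range (N + 1))) {A : Finset ℕ}
    (hA : A ∈ E.nonMemberSubfamily N) {x : ℕ} (hx : x ∈ A) :
    A.erase x ∈ E.memberSubfamily N := by
  have hxN := mem_range.1
    ((mem_powersetCard.1 (nonMemberSubfamily_subset_powersetCard hE hA)).1 hx)
  rw [mem_nonMemberSubfamily] at hA
  rw [mem_memberSubfamily]
  exact ⟨h A hA.1 x hx N hA.2 hxN (by omega), fun h' => hA.2 (mem_of_mem_erase h')⟩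

theorem choose_pred_add_choose_pred (a j : ℕ) :
    (a - 1).choose (j + 1) + (a - 1).choose (j + 2) = a.choose (j + 2) := by
  rcases a with _ | a
  · simp
  · simp [Nat.choose_succ_succ']

theorem choose_le_choose_pred_add (a j : ℕ) :
    a.choose (j + 1) ≤ (a - 1).choose (j + 1) + (a - 1).choose j := by
  rcases a with _ | a
  · simp
  · simp [Nat.choose_succ_succ', add_comm]

/-- The Kruskal–Katona inequality for an up-shifted family. The numbers `d j` are arbitrary:
they need not form a cascade, and this freedom lets the induction on `N` replace each `d j` by
its predecessor without case distinctions. -/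
theorem IsUpShifted.sum_choose_lt_card {N ℓ : ℕ} {E U : Finset (Finset ℕ)} {d : ℕ → ℕ}
    (hs : IsUpShifted N E) (hE : E ⊆ powersetCard (ℓ + 1) (range N))
    (hU : ∀ A ∈ E, ∀ x ∈ A, A.erase x ∈ U)
    (h : ∑ j ∈ range ℓ, (d j).choose (j + 2) < #E) :
    ∑ j ∈ range ℓ, (d j).choose (j + 1) < #U := by
  induction N generalizing ℓ E U d with
  | zero =>
    have hE0 : E ⊆ ∅ := hE.trans (powersetCard_eq_empty.2 (by simp)).le
    rw [subset_empty.1 hE0, card_empty] at h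
    omega
  | succ N ih =>
    obtain _ | ℓ := ℓ
    · obtain ⟨A, hA⟩ := card_pos.1 (by simpa using h)
      obtain ⟨x, hx⟩ : A.Nonempty := by
        rw [← card_pos, (mem_powersetCard.1 (hE hA)).2]
        omega
      simpa using card_pos.2 ⟨_, hU A hA x hx⟩
    · have hcE := card_memberSubfamily_add_card_nonMemberSubfamily N E
      have hcU := card_memberSubfamily_add_card_nonMemberSubfamily N U
      -- The link of `N` is large: otherwise the members avoiding `N` are many, hence so are the
      -- sets in their shadow, all of which lie in the link.
      have hG : ∑ j ∈ range (ℓ + 1), (d j - 1).choose (j + 1) < #(E.memberSubfamily N) := by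
        by_contra hcon
        refine hcon (ih hs.nonMemberSubfamily (nonMemberSubfamily_subset_powersetCard hE)
          (fun A hA x hx => hs.erase_mem_memberSubfamily hE hA hx) ?_)
        have := sum_congr (rfl : range (ℓ + 1) = _)
          fun j _ => choose_pred_add_choose_pred (d j) j
        rw [sum_add_distrib] at this
        omega
      -- The shadow contains the link of `N` and, joined with `N`, the shadow of that link.
      have hGU : E.memberSubfamily N ⊆ U.nonMemberSubfamily N := by
        intro A hA
        rw [mem_memberSubfamily] at hA
        rw [mem_nonMemberSubfamily]
        refine ⟨?_, hA.2⟩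
        simpa [erase_insert hA.2] using hU _ hA.1 N (mem_insert_self _ _)
      have hlink : ∑ j ∈ range ℓ, (d (j + 1) - 1).choose (j + 1) < #(U.memberSubfamily N) := by
        refine ih (d := fun j => d (j + 1) - 1) hs.memberSubfamily
          (memberSubfamily_subset_powersetCard hE) (fun A hA x hx => ?_) ?_
        · rw [mem_memberSubfamily] at hA ⊢
          have hxN : N ≠ x := by
            rintro rfl
            exact hA.2 hx
          refine ⟨?_, fun h' => hA.2 (mem_of_mem_erase h')⟩
          rw [← erase_insert_of_ne hxN]
          exact hU _ hA.1 x (mem_insert_of_mem hx)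
        · refine lt_of_le_of_lt ?_ hG
          rw [sum_range_succ']
          exact Nat.le_add_right _ _
      have hle := sum_le_sum fun j (_ : j ∈ range (ℓ + 1)) => choose_le_choose_pred_add (d j) j
      rw [sum_add_distrib, sum_range_succ' (fun j => (d j - 1).choose j)] at hle
      have := card_le_card hGU
      simp only [Nat.choose_zero_right] at hle
      omega

theorem IsUpShifted.card_nonMemberSubfamily_le {N ℓ : ℕ} {E : Finset (Finset ℕ)} {d : ℕ → ℕ}
    (hs : IsUpShifted (N + 1) E) (hE : E ⊆ powersetCard ℓ (range (N + 1)))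
    (h : #E ≤ ∑ j ∈ range ℓ, (d j).choose (j + 1)) :
    #(E.nonMemberSubfamily N) ≤ ∑ j ∈ range ℓ, (d j - 1).choose (j + 1) := by
  have hcE := card_memberSubfamily_add_card_nonMemberSubfamily N E
  obtain _ | ℓ := ℓ
  · simp only [range_zero, sum_empty] at h ⊢
    omega
  · by_contra! hcon
    -- The shadow of the members avoiding `N` lies in the link of `N`, so `E` is at least as large
    -- as these members and their shadow together.
    have := hs.nonMemberSubfamily.sum_choose_lt_card (ℓ := ℓ) (d := fun j => d (j + 1) - 1)
      (nonMemberSubfamily_subset_powersetCard hE)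
      (fun A hA x hx => hs.erase_mem_memberSubfamily hE hA hx)
      (by
        refine lt_of_le_of_lt ?_ hcon
        rw [sum_range_succ']
        exact Nat.le_add_right _ _)
    have hle := sum_le_sum fun j (_ : j ∈ range (ℓ + 1)) => choose_le_choose_pred_add (d j) j
    rw [sum_add_distrib, sum_range_succ' (fun j => (d j - 1).choose j)] at hle
    simp only [Nat.choose_zero_right] at hle
    omega

/-- A bound for the number of members of an up-shifted family that avoid the top `m` points, in
terms of any `d` with `#E ≤ ∑ C(d j, j + 1)`. -/
theorem IsUpShifted.card_filter_subset_range_le {s m ℓ : ℕ} {E : Finset (Finset ℕ)} {d : ℕ → ℕ}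
    (hs : IsUpShifted (s + m) E) (hE : E ⊆ powersetCard ℓ (range (s + m)))
    (h : #E ≤ ∑ j ∈ range ℓ, (d j).choose (j + 1)) :
    #{A ∈ E | A ⊆ range s} ≤ ∑ j ∈ range ℓ, (d j - m).choose (j + 1) := by
  induction m generalizing E d with
  | zero => exact (card_filter_le _ _).trans h
  | succ m ih =>
    have := ih hs.nonMemberSubfamily (nonMemberSubfamily_subset_powersetCard hE)
      (hs.card_nonMemberSubfamily_le hE h)
    simp only [Nat.sub_sub, add_comm 1 m] at this
    refine le_trans (card_le_card fun A hA => ?_) this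
    rw [mem_filter] at hA ⊢
    refine ⟨mem_nonMemberSubfamily.2 ⟨hA.1, fun h' => ?_⟩, hA.2⟩
    have : s + m < s := mem_range.1 (hA.2 h')
    omega

/-- A family closed under raising an element by one, when there is room, is up-shifted. -/
theorem isUpShifted_of_succ {N : ℕ} {E : Finset (Finset ℕ)}
    (h : ∀ A ∈ E, ∀ x ∈ A, x + 1 ∉ A → x + 1 < N → insert (x + 1) (A.erase x) ∈ E) :
    IsUpShifted N E := by
  intro A hA x hx y hy hxy hyN
  obtain ⟨k, rfl⟩ : ∃ k, y = x + 1 + k := ⟨y - (x + 1), by omega⟩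
  clear hxy
  induction k generalizing A x with
  | zero => exact h A hA x hx hy hyN
  | succ k ih =>
    have e : x + 1 + (k + 1) = x + 1 + 1 + k := by omega
    rw [e] at hy hyN ⊢
    by_cases hx1 : x + 1 ∈ A
    -- The occupied point `x + 1` moves away first, and `x` takes its place.
    · have := h _ (ih A hA (x + 1) hx1 hy hyN) x
        (mem_insert_of_mem (mem_erase.2 ⟨by omega, hx⟩)) (by simp; omega) (by omega)
      convert this using 1
      ext z
      simp only [mem_insert, mem_erase]
      by_cases hz : z = x + 1
      · subst hz; simp [hx1]
      · constructor
        · rintro (rfl | h1)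
          · exact Or.inr ⟨by omega, Or.inl rfl⟩
          · exact Or.inr ⟨h1.1, Or.inr ⟨hz, h1.2⟩⟩
        · rintro (h1 | ⟨h1, h2 | h2⟩)
          · exact absurd h1 hz
          · exact Or.inl h2
          · exact Or.inr ⟨h1, h2.2⟩
    · have := ih _ (h A hA x hx hx1 (by omega)) (x + 1) (mem_insert_self _ _)
        (by simp only [mem_insert, mem_erase, not_or, not_and]; exact ⟨by omega, fun _ => hy⟩) hyN
      rwa [erase_insert (fun h' => hx1 (mem_of_mem_erase h'))] at this

/-- A truncated hockey-stick inequality. -/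
theorem sum_range_choose_sub_le (a s j M : ℕ) :
    ∑ q ∈ range M, (a - (s + q)).choose (j + 1) ≤ (a + 1 - s).choose (j + 2) := by
  induction M generalizing s with
  | zero => simp
  | succ M ih =>
    rw [sum_range_succ']
    have h1 := ih (s + 1)
    simp only [show ∀ q, s + 1 + q = s + (q + 1) by intro q; omega] at h1
    refine (Nat.add_le_add_right h1 _).trans ?_
    rcases le_or_gt s a with hs | hs
    · obtain ⟨r, rfl⟩ := Nat.exists_eq_add_of_le hs
      rw [show s + r + 1 - s = r + 1 by omega, show s + r + 1 - (s + 1) = r by omega,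
        show s + r - (s + 0) = r by omega, Nat.choose_succ_succ' r (j + 1), add_comm]
    · rw [show a + 1 - (s + 1) = 0 by omega, show a - (s + 0) = 0 by omega]
      simp

/-! ### Cascades of binomial coefficients -/

/-- A cascade is a sequence `c 0 < ⋯ < c ℓ`; its sum `∑ C(c k, k + 1)` is less than the first
binomial coefficient `C(m, ℓ + 1)` with `m > c ℓ`. -/
theorem sum_cascade_lt_choose {ℓ : ℕ} {c : ℕ → ℕ} (hc : StrictMonoOn c (Set.Iio (ℓ + 1))) :
    ∑ k ∈ range (ℓ + 1), (c k).choose (k + 1) < (c ℓ + 1).choose (ℓ + 1) := by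
  induction ℓ with
  | zero => simp
  | succ ℓ ih =>
    rw [sum_range_succ, Nat.choose_succ_succ' (c (ℓ + 1)) (ℓ + 1)]
    have h1 := ih (hc.mono (Set.Iio_subset_Iio (by omega)))
    have h2 : c ℓ < c (ℓ + 1) := hc (by simp) (by simp) (by omega)
    have := Nat.choose_le_choose (ℓ + 1) (show c ℓ + 1 ≤ c (ℓ + 1) from h2)
    omega

theorem sum_shifted_cascade_le_choose {ℓ s : ℕ} {c : ℕ → ℕ}
    (hc : StrictMonoOn c (Set.Iio (ℓ + 1))) :
    ∑ k ∈ range (ℓ + 1), (c k + 1 - s).choose (k + 2) ≤ (c ℓ + 2 - s).choose (ℓ + 2) := by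
  induction ℓ with
  | zero =>
    simp only [zero_add, range_one, sum_singleton]
    exact Nat.choose_le_choose _ (by omega)
  | succ ℓ ih =>
    rw [sum_range_succ]
    have h1 := ih (hc.mono (Set.Iio_subset_Iio (by omega)))
    have h2 : c ℓ < c (ℓ + 1) := hc (by simp) (by simp) (by omega)
    have h3 := Nat.choose_le_choose (ℓ + 2) (show c ℓ + 2 - s ≤ c (ℓ + 1) + 1 - s by omega)
    rw [show ℓ + 1 + 2 = ℓ + 2 + 1 from rfl]
    rcases le_or_gt s (c (ℓ + 1) + 1) with hs | hs
    · rw [show c (ℓ + 1) + 2 - s = c (ℓ + 1) + 1 - s + 1 by omega, Nat.choose_succ_succ' _ (ℓ + 2)]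
      omega
    · rw [show c (ℓ + 1) + 1 - s = 0 by omega] at h3 ⊢
      simp only [Nat.choose_zero_succ] at h3 ⊢
      omega

theorem sum_cascade_lt_of_top_lt {ℓ : ℕ} {c a : ℕ → ℕ} (hc : StrictMonoOn c (Set.Iio (ℓ + 1)))
    (h : c ℓ < a ℓ) :
    ∑ k ∈ range (ℓ + 1), (c k).choose (k + 1) < ∑ k ∈ range (ℓ + 1), (a k).choose (k + 1) := by
  refine (sum_cascade_lt_choose hc).trans_le ((Nat.choose_le_choose (ℓ + 1) h).trans ?_)
  rw [sum_range_succ]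
  exact Nat.le_add_left _ _

theorem cascade_unique {ℓ : ℕ} {c a : ℕ → ℕ} (hc : StrictMonoOn c (Set.Iio ℓ))
    (ha : StrictMonoOn a (Set.Iio ℓ))
    (h : ∑ k ∈ range ℓ, (c k).choose (k + 1) = ∑ k ∈ range ℓ, (a k).choose (k + 1)) :
    ∀ k < ℓ, c k = a k := by
  induction ℓ with
  | zero => simp
  | succ ℓ ih =>
    have htop : c ℓ = a ℓ := by
      rcases lt_trichotomy (c ℓ) (a ℓ) with h' | h' | h'
      · exact absurd h (sum_cascade_lt_of_top_lt hc h').ne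
      · exact h'
      · exact absurd h (sum_cascade_lt_of_top_lt ha h').ne'
    rw [sum_range_succ, sum_range_succ, htop, add_left_inj] at h
    intro k hk
    rcases Nat.lt_succ_iff_lt_or_eq.1 hk with hk | rfl
    · exact ih (hc.mono (Set.Iio_subset_Iio (by omega))) (ha.mono (Set.Iio_subset_Iio (by omega)))
        h k hk
    · exact htop

/-- The operator `∑ C(c k, k + 1) ↦ ∑ C(c k + 1 - s, k + 2)` is monotone. -/
theorem sum_shifted_cascade_mono {ℓ s : ℕ} {c a : ℕ → ℕ} (hc : StrictMonoOn c (Set.Iio ℓ))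
    (ha : StrictMonoOn a (Set.Iio ℓ))
    (h : ∑ k ∈ range ℓ, (c k).choose (k + 1) ≤ ∑ k ∈ range ℓ, (a k).choose (k + 1)) :
    ∑ k ∈ range ℓ, (c k + 1 - s).choose (k + 2) ≤
      ∑ k ∈ range ℓ, (a k + 1 - s).choose (k + 2) := by
  induction ℓ with
  | zero => simp
  | succ ℓ ih =>
    rcases lt_trichotomy (c ℓ) (a ℓ) with h' | h' | h'
    · refine (sum_shifted_cascade_le_choose hc).trans ?_
      refine (Nat.choose_le_choose (ℓ + 2) (show c ℓ + 2 - s ≤ a ℓ + 1 - s by omega)).trans ?_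
      rw [sum_range_succ (fun k => (a k + 1 - s).choose (k + 2))]
      exact Nat.le_add_left _ _
    · rw [sum_range_succ, sum_range_succ, h'] at h ⊢
      exact Nat.add_le_add_right (ih (hc.mono (Set.Iio_subset_Iio (by omega)))
        (ha.mono (Set.Iio_subset_Iio (by omega))) (by omega)) _
    · exact absurd h (sum_cascade_lt_of_top_lt ha h').not_ge

/-- A sum over `p + i, …, ℓ + i`, as a sum over `range ℓ` padded with zeros. -/
theorem sum_Icc_eq_sum_range_of_pad {p ℓ i : ℕ} {g F : ℕ → ℕ} (hp : 1 ≤ p)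
    (hF0 : ∀ k, k + 1 < p → F k = 0) (hF : ∀ k, p ≤ k + 1 → F k = g (k + 1 + i)) :
    ∑ j ∈ Icc (p + i) (ℓ + i), g j = ∑ k ∈ range ℓ, F k := by
  refine sum_of_injOn (fun j => j - (1 + i)) ?_ ?_ ?_ ?_
  · intro x hx y hy hxy
    simp only [coe_Icc, Set.mem_Icc] at hx hy hxy
    omega
  · intro x hx
    simp only [coe_Icc, Set.mem_Icc, coe_range, Set.mem_Iio] at hx ⊢
    omega
  · intro k hk hk'
    rw [mem_range] at hk
    refine hF0 k (not_le.1 fun hpk => hk' ⟨k + 1 + i, ?_, ?_⟩)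
    · simp only [coe_Icc, Set.mem_Icc]
      omega
    · dsimp only
      omega
  · intro j hj
    rw [mem_Icc] at hj
    rw [hF _ (by omega)]
    congr 1
    omega

/-- Padding a binomial expansion with the terms `C(k, k + 1) = 0` gives a cascade with exactly `ℓ`
terms, available also for `a = 0`; the padding contributes nothing to `expansionShift` either. -/
theorem exists_cascade (ℓ a : ℕ) (hℓ : 1 ≤ ℓ) :
    ∃ c : ℕ → ℕ, StrictMonoOn c (Set.Iio ℓ) ∧ a = ∑ k ∈ range ℓ, (c k).choose (k + 1) ∧
      ∀ s, expansionShift ℓ s a = ∑ k ∈ range ℓ, (c k + 1 - s).choose (k + 2) := by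
  rcases Nat.eq_zero_or_pos a with rfl | ha
  · refine ⟨id, strictMono_id.strictMonoOn _, ?_, fun s => ?_⟩
    · simp
    · rw [expansionShift, dif_neg]
      · refine (sum_eq_zero fun k _ => Nat.choose_eq_zero_of_lt ?_).symm
        simp only [id]
        omega
      · rintro ⟨⟨p, c⟩, h1, h2, h3, -, h5⟩
        have := single_le_sum (f := fun j => (c j).choose j) (fun _ _ => Nat.zero_le _)
          (mem_Icc.2 ⟨le_rfl, h2⟩)
        have := Nat.choose_pos h3
        dsimp only at *
        omega
  · obtain ⟨p, c, hc⟩ := exists_isBinomialExpansion hℓ ha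
    have hshift := expansionShift_eq hc
    obtain ⟨h1, h2, h3, h4, h5⟩ := hc
    have hge : ∀ k, p ≤ k → k ≤ ℓ → k ≤ c k := by
      intro k hpk
      induction k, hpk using Nat.le_induction with
      | base => exact fun _ => h3
      | succ k hk ih =>
        intro hkℓ
        have := h4 ⟨hk, by omega⟩ ⟨by omega, hkℓ⟩ (Nat.lt_succ_self k)
        have := ih (by omega)
        omega
    refine ⟨fun k => if k + 1 < p then k else c (k + 1), ?_, ?_, fun s => ?_⟩
    · intro x hx y hy hxy
      simp only [Set.mem_Iio] at hx hy
      dsimp only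
      split_ifs with hxp hyp hyp
      · exact hxy
      · have := hge (y + 1) (by omega) (by omega)
        omega
      · omega
      · exact h4 ⟨by omega, by omega⟩ ⟨by omega, by omega⟩ (by omega)
    · rw [h5]
      refine sum_Icc_eq_sum_range_of_pad (i := 0) h1 (fun k hk => ?_) (fun k hk => ?_)
      · simp [hk]
      · simp [not_lt.2 hk]
    · rw [hshift]
      refine sum_Icc_eq_sum_range_of_pad (i := 1) h1 (fun k hk => ?_) (fun k hk => ?_)
      · simp only [hk, if_true]
        exact Nat.choose_eq_zero_of_lt (by omega)
      · simp [not_lt.2 hk]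

/-! ### Index sequences of spread monomials -/

/-- The sequence of indices `w 0, …, w (ℓ - 1)` has gaps at least `τ 0, …, τ (ℓ - 2)`. It encodes a
spread monomial of degree `ℓ`. -/
def IsSpreadSeq {n ℓ : ℕ} (τ : ℕ → ℕ) (w : Fin ℓ → Fin n) : Prop :=
  ∀ (i : ℕ) (h : i + 1 < ℓ), (w ⟨i, Nat.lt_of_succ_lt h⟩ : ℕ) + τ i ≤ w ⟨i + 1, h⟩

/-- The exponent vector of the monomial with the given sequence of variable indices. -/
noncomputable def seqMonomial {n ℓ : ℕ} (w : Fin ℓ → Fin n) : Fin n →₀ ℕ :=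
  ∑ i, Finsupp.single (w i) 1

theorem IsSpreadSeq.add_sum_le {n ℓ : ℕ} {τ : ℕ → ℕ} {w : Fin ℓ → Fin n} (h : IsSpreadSeq τ w)
    {i k : ℕ} (hik : i ≤ k) (hk : k < ℓ) :
    (w ⟨i, hik.trans_lt hk⟩ : ℕ) + ∑ r ∈ Ico i k, τ r ≤ w ⟨k, hk⟩ := by
  induction k, hik using Nat.le_induction with
  | base => simp
  | succ k hik ih =>
    rw [sum_Ico_succ_top hik]
    have := ih (by omega)
    have := h k hk
    omega

theorem IsSpreadSeq.monotone {n ℓ : ℕ} {τ : ℕ → ℕ} {w : Fin ℓ → Fin n} (h : IsSpreadSeq τ w) :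
    Monotone w := by
  intro i k hik
  have := h.add_sum_le (i := i) (k := k) hik k.2
  exact Fin.le_def.2 (by simpa using (Nat.le_add_right _ _).trans this)

theorem IsSpreadSeq.init {n ℓ : ℕ} {τ : ℕ → ℕ} {w : Fin (ℓ + 1) → Fin n} (h : IsSpreadSeq τ w) :
    IsSpreadSeq τ (Fin.init w) :=
  fun i hi => h i (by omega)

theorem degree_seqMonomial {n ℓ : ℕ} (w : Fin ℓ → Fin n) : (seqMonomial w).degree = ℓ := by
  simp [seqMonomial, map_sum, Finsupp.degree_single]

theorem seqMonomial_succ {n ℓ : ℕ} (w : Fin (ℓ + 1) → Fin n) :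
    seqMonomial w = seqMonomial (Fin.init w) + Finsupp.single (w (Fin.last ℓ)) 1 :=
  Fin.sum_univ_castSucc _

theorem seqMonomial_update {n ℓ : ℕ} (w : Fin ℓ → Fin n) (i : Fin ℓ) (b : Fin n) :
    seqMonomial (Function.update w i b) + Finsupp.single (w i) 1 =
      seqMonomial w + Finsupp.single b 1 := by
  have h1 := Finset.sum_erase_add univ (fun k => Finsupp.single (w k) (1 : ℕ)) (mem_univ i)
  have h2 := Finset.sum_erase_add univ
    (fun k => Finsupp.single (Function.update w i b k) (1 : ℕ)) (mem_univ i)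
  have h3 : ∑ k ∈ univ.erase i, Finsupp.single (Function.update w i b k) (1 : ℕ) =
      ∑ k ∈ univ.erase i, Finsupp.single (w k) (1 : ℕ) :=
    sum_congr rfl fun k hk => by rw [Function.update_of_ne (ne_of_mem_erase hk)]
  rw [seqMonomial, seqMonomial, ← h1, ← h2, h3]
  simp only [Function.update_self]
  abel

theorem seqMonomial_apply {n ℓ : ℕ} (w : Fin ℓ → Fin n) (x : Fin n) :
    seqMonomial w x = #{i | w i = x} := by
  simp [seqMonomial, Finsupp.finsetSum_apply, Finsupp.single_apply]

theorem sum_seqMonomial {n ℓ : ℕ} (w : Fin ℓ → Fin n) (m : Fin n) :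
    ∑ x ∈ Iic m, seqMonomial w x = #{i | w i ≤ m} := by
  rw [card_eq_sum_card_fiberwise (f := w) (t := Iic m) (fun i hi => by simpa using hi)]
  refine sum_congr rfl fun x hx => ?_
  rw [seqMonomial_apply, filter_filter]
  congr 1
  ext i
  simp only [mem_filter, mem_univ, true_and]
  rw [mem_Iic] at hx
  constructor
  · rintro rfl; exact ⟨hx, rfl⟩
  · exact fun h => h.2

/-- Comparison of the partial sums of the exponents compares the index sequences entrywise. -/
theorem exists_le_of_sum_le {n ℓ ℓ' : ℕ} {w : Fin ℓ → Fin n} {w' : Fin ℓ' → Fin n}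
    (hw : Monotone w) (hw' : Monotone w')
    (h : ∀ m, ∑ x ∈ Iic m, seqMonomial w x ≤ ∑ x ∈ Iic m, seqMonomial w' x) (i : Fin ℓ) :
    ∃ hi : (i : ℕ) < ℓ', w' ⟨i, hi⟩ ≤ w i := by
  have h1 := h (w i)
  rw [sum_seqMonomial, sum_seqMonomial] at h1
  have h2 : #(Iic i) ≤ #{k | w k ≤ w i} :=
    card_le_card fun k hk => by simpa using hw (mem_Iic.1 hk)
  rw [Fin.card_Iic] at h2
  have h3 := card_le_univ {k | w' k ≤ w i}
  rw [Fintype.card_fin] at h3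
  have hi : (i : ℕ) < ℓ' := by omega
  refine ⟨hi, ?_⟩
  by_contra! hcon
  have h4 : #{k | w' k ≤ w i} ≤ #(Iio (⟨i, hi⟩ : Fin ℓ')) := card_le_card fun k hk => by
    rw [mem_Iio]
    by_contra! hk'
    exact ((hcon.trans_le (hw' hk')).trans_le (mem_filter.1 hk).2).false
  rw [Fin.card_Iio] at h4
  dsimp only at h4
  omega

theorem eq_of_seqMonomial_eq {n ℓ : ℕ} {w w' : Fin ℓ → Fin n} (hw : Monotone w)
    (hw' : Monotone w') (h : seqMonomial w = seqMonomial w') : w = w' :=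
  funext fun i => le_antisymm (exists_le_of_sum_le hw' hw (fun _ => by rw [h]) i).2
    (exists_le_of_sum_le hw hw' (fun _ => by rw [h]) i).2

/-- Subtracting the required gaps and adding the position turns a spread sequence into a strictly
increasing one. The subtraction is never truncated on spread sequences. -/
def code {n ℓ : ℕ} (τ : ℕ → ℕ) (w : Fin ℓ → Fin n) (i : Fin ℓ) : ℕ :=
  w i + i - ∑ r ∈ range i, τ r

/-- The set of entries of `code τ w`. -/
def codeSet {n ℓ : ℕ} (τ : ℕ → ℕ) (w : Fin ℓ → Fin n) : Finset ℕ :=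
  univ.image (code τ w)

/-- The codes of spread sequences of length `ℓ` lie below this bound. -/
def codeBound (n ℓ : ℕ) (τ : ℕ → ℕ) : ℕ :=
  n + ℓ - 1 - ∑ r ∈ range (ℓ - 1), τ r

theorem IsSpreadSeq.sum_range_le {n ℓ : ℕ} {τ : ℕ → ℕ} {w : Fin ℓ → Fin n} (h : IsSpreadSeq τ w)
    (i : Fin ℓ) : ∑ r ∈ range i, τ r ≤ w i := by
  have := h.add_sum_le (Nat.zero_le i) i.2
  rw [Nat.Ico_zero_eq_range] at this
  exact (Nat.le_add_left _ _).trans this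

theorem IsSpreadSeq.code_add {n ℓ : ℕ} {τ : ℕ → ℕ} {w : Fin ℓ → Fin n} (h : IsSpreadSeq τ w)
    (i : Fin ℓ) : code τ w i + ∑ r ∈ range i, τ r = w i + i := by
  have := h.sum_range_le i
  rw [code]
  omega

theorem IsSpreadSeq.code_strictMono {n ℓ : ℕ} {τ : ℕ → ℕ} {w : Fin ℓ → Fin n}
    (h : IsSpreadSeq τ w) : StrictMono (code τ w) := by
  intro i k hik
  have h1 := h.add_sum_le (i := i) (k := k) hik.le k.2
  have h2 := h.code_add i
  have h3 := h.code_add k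
  have h4 := sum_range_add_sum_Ico τ (show (i : ℕ) ≤ k from hik.le)
  have h5 : (i : ℕ) < k := hik
  simp only [Fin.eta] at h1
  omega

theorem IsSpreadSeq.code_lt {n ℓ : ℕ} {τ : ℕ → ℕ} {w : Fin ℓ → Fin n} (h : IsSpreadSeq τ w)
    (i : Fin ℓ) : code τ w i < codeBound n ℓ τ := by
  have hi := i.2
  have h1 := h.add_sum_le (i := i) (k := ℓ - 1) (by omega) (by omega)
  have h2 := h.code_add i
  have h4 := sum_range_add_sum_Ico τ (show (i : ℕ) ≤ ℓ - 1 by omega)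
  have h5 := (w ⟨ℓ - 1, by omega⟩).2
  simp only [Fin.eta] at h1
  rw [codeBound]
  omega

theorem IsSpreadSeq.codeSet_mem {n ℓ : ℕ} {τ : ℕ → ℕ} {w : Fin ℓ → Fin n} (h : IsSpreadSeq τ w) :
    codeSet τ w ∈ powersetCard ℓ (range (codeBound n ℓ τ)) := by
  rw [mem_powersetCard, codeSet, card_image_of_injective _ h.code_strictMono.injective]
  refine ⟨fun x hx => ?_, by simp⟩
  obtain ⟨i, -, rfl⟩ := mem_image.1 hx
  exact mem_range.2 (h.code_lt i)

theorem eq_of_codeSet_eq {n ℓ : ℕ} {τ : ℕ → ℕ} {w w' : Fin ℓ → Fin n} (h : IsSpreadSeq τ w)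
    (h' : IsSpreadSeq τ w') (e : codeSet τ w = codeSet τ w') : w = w' := by
  have e1 : Set.range (code τ w) = Set.range (code τ w') := by
    simpa [codeSet] using congrArg (fun s : Finset ℕ => (s : Set ℕ)) e
  have e2 := (StrictMono.range_inj h.code_strictMono h'.code_strictMono).1 e1
  funext i
  have h1 := h.code_add i
  have h2 := h'.code_add i
  rw [e2] at h1
  exact Fin.ext (by omega)

/-- Raising an element of the code set by one, when there is room, is raising one index of the
spread sequence by one. -/
theorem IsSpreadSeq.exists_raise {n ℓ : ℕ} {τ : ℕ → ℕ} {w : Fin ℓ → Fin n} (h : IsSpreadSeq τ w)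
    {x : ℕ} (hx : x ∈ codeSet τ w) (hx1 : x + 1 ∉ codeSet τ w) (hN : x + 1 < codeBound n ℓ τ) :
    ∃ (i : Fin ℓ) (b : Fin n), w i < b ∧ IsSpreadSeq τ (Function.update w i b) ∧
      codeSet τ (Function.update w i b) = insert (x + 1) ((codeSet τ w).erase x) := by
  obtain ⟨i, -, rfl⟩ := mem_image.1 hx
  have hi := i.2
  -- the next index leaves room for raising `w i`
  have hnext : ∀ hi' : (i : ℕ) + 1 < ℓ, (w i : ℕ) + 1 + τ i ≤ w ⟨i + 1, hi'⟩ := by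
    intro hi'
    have h1 := h.code_add i
    have h2 := h.code_add ⟨i + 1, hi'⟩
    have h3 : code τ w i < code τ w ⟨i + 1, hi'⟩ := h.code_strictMono (Nat.lt_succ_self i)
    have h4 : code τ w ⟨i + 1, hi'⟩ ≠ code τ w i + 1 := fun e =>
      hx1 (e ▸ mem_image_of_mem _ (mem_univ _))
    dsimp only at h2
    rw [sum_range_succ] at h2
    omega
  have hb : (w i : ℕ) + 1 < n := by
    rcases Nat.lt_or_ge ((i : ℕ) + 1) ℓ with hi' | hi'
    · exact (Nat.le_add_right _ _).trans_lt ((hnext hi').trans_lt (Fin.is_lt _))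
    · have h1 := h.code_add i
      rw [codeBound, show ℓ - 1 = i by omega] at hN
      omega
  have hspread : IsSpreadSeq τ (Function.update w i ⟨w i + 1, hb⟩) := by
    intro k hk
    have h1 := h k hk
    by_cases hki : k = i
    · subst hki
      have e : (⟨i + 1, hk⟩ : Fin ℓ) ≠ i := by simp [Fin.ext_iff]
      rw [Function.update_of_ne e]
      simpa using hnext hk
    · rw [Function.update_of_ne (by simpa [Fin.ext_iff] using hki)]
      by_cases hki' : k + 1 = i
      · have e : (⟨k + 1, hk⟩ : Fin ℓ) = i := Fin.ext hki'
        rw [e] at h1 ⊢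
        rw [Function.update_self]
        dsimp only
        omega
      · rwa [Function.update_of_ne (by simpa [Fin.ext_iff] using hki')]
  refine ⟨i, ⟨w i + 1, hb⟩, Fin.lt_def.2 (Nat.lt_succ_self _), hspread, ?_⟩
  have hself : code τ (Function.update w i ⟨w i + 1, hb⟩) i = code τ w i + 1 := by
    have h1 := h.code_add i
    have h2 := hspread.code_add i
    rw [Function.update_self] at h2
    dsimp only at h2
    omega
  have hne : ∀ k, k ≠ i → code τ (Function.update w i ⟨w i + 1, hb⟩) k = code τ w k := by
    intro k hk
    rw [code, code, Function.update_of_ne hk]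
  ext y
  simp only [codeSet, mem_image, mem_univ, true_and, mem_insert, mem_erase]
  constructor
  · rintro ⟨k, rfl⟩
    by_cases hk : k = i
    · exact Or.inl (hk ▸ hself)
    · rw [hne k hk]
      exact Or.inr ⟨fun e => hk (h.code_strictMono.injective e), k, rfl⟩
  · rintro (rfl | ⟨hy, k, rfl⟩)
    · exact ⟨i, hself⟩
    · exact ⟨k, hne k fun e => hy (e ▸ rfl)⟩

theorem codeBound_succ {n ℓ : ℕ} {τ : ℕ → ℕ} (hℓ : 1 ≤ ℓ) {s : ℕ}
    (hs : s < codeBound n (ℓ + 1) τ) : s + τ (ℓ - 1) ≤ codeBound n ℓ τ := by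
  obtain ⟨ℓ, rfl⟩ := Nat.exists_eq_add_of_le' hℓ
  simp only [codeBound, Nat.add_sub_cancel, sum_range_succ] at hs ⊢
  omega

/-- The Macaulay-type bound for spread sequences: if `A` is closed under raising indices and every
member of `B` restricts to a member of `A`, then `#B` is bounded in terms of `#A`. -/
theorem card_le_expansionShift {n ℓ : ℕ} {τ : ℕ → ℕ} (hℓ : 1 ≤ ℓ)
    {A : Finset (Fin ℓ → Fin n)} {B : Finset (Fin (ℓ + 1) → Fin n)}
    (hA : ∀ w ∈ A, IsSpreadSeq τ w)
    (hup : ∀ w ∈ A, ∀ i b, w i < b → IsSpreadSeq τ (Function.update w i b) →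
      Function.update w i b ∈ A)
    (hB : ∀ w ∈ B, IsSpreadSeq τ w) (hinit : ∀ w ∈ B, Fin.init w ∈ A) :
    #B ≤ expansionShift ℓ (τ (ℓ - 1)) #A := by
  obtain ⟨c, -, hcA, hc⟩ := exists_cascade ℓ #A hℓ
  rw [hc]
  set N := codeBound n ℓ τ
  set N' := codeBound n (ℓ + 1) τ
  set E := A.image (codeSet τ) with hEdef
  have hE : E ⊆ powersetCard ℓ (range N) := by
    intro S hS
    obtain ⟨w, hw, rfl⟩ := mem_image.1 hS
    exact (hA w hw).codeSet_mem
  have hcard : #E = #A :=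
    card_image_of_injOn fun w hw w' hw' e => eq_of_codeSet_eq (hA w hw) (hA w' hw') e
  have hshift : IsUpShifted N E := by
    refine isUpShifted_of_succ fun S hS x hx hx1 hN => ?_
    obtain ⟨w, hw, rfl⟩ := mem_image.1 hS
    obtain ⟨i, b, hib, hsp, he⟩ := (hA w hw).exists_raise hx hx1 hN
    rw [← he]
    exact mem_image_of_mem _ (hup w hw i b hib hsp)
  -- a member of `B` is determined by its last code `s` and the code set of its initial part
  have hBle : #B ≤ ∑ s ∈ range N', #{S ∈ E | S ⊆ range s} := by
    rw [← card_sigma]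
    refine card_le_card_of_injOn (fun w => ⟨code τ w (Fin.last ℓ), codeSet τ (Fin.init w)⟩) ?_ ?_
    · intro w hw
      simp only [coe_sigma, Set.mem_sigma_iff, mem_coe, mem_range, mem_filter]
      refine ⟨(hB w hw).code_lt _, mem_image_of_mem _ (hinit w hw), fun x hx => ?_⟩
      obtain ⟨i, -, rfl⟩ := mem_image.1 hx
      exact mem_range.2 ((hB w hw).code_strictMono (Fin.castSucc_lt_last i))
    · intro w hw w' hw' e
      simp only [Sigma.mk.injEq, heq_eq_eq] at e
      have e1 := eq_of_codeSet_eq (hB w hw).init (hB w' hw').init e.2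
      have h1 := (hB w hw).code_add (Fin.last ℓ)
      have h2 := (hB w' hw').code_add (Fin.last ℓ)
      rw [← Fin.snoc_init_self w, ← Fin.snoc_init_self w', e1]
      congr 1
      exact Fin.ext (by omega)
  refine hBle.trans ?_
  -- for `s = N' - 1 - q`, avoiding the points from `s` on means avoiding the top
  -- `N - s ≥ τ (ℓ - 1) + q` points below `N`
  rw [← sum_range_reflect]
  calc ∑ q ∈ range N', #{S ∈ E | S ⊆ range (N' - 1 - q)}
      ≤ ∑ q ∈ range N', ∑ j ∈ range ℓ, (c j - (τ (ℓ - 1) + q)).choose (j + 1) := by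
        refine sum_le_sum fun q hq => ?_
        rw [mem_range] at hq
        have h1 := codeBound_succ (n := n) (τ := τ) hℓ (s := N' - 1) (by omega)
        obtain ⟨m, hm⟩ : ∃ m, N = N' - 1 - q + m := ⟨N - (N' - 1 - q), by omega⟩
        rw [hm] at hE hshift
        refine (hshift.card_filter_subset_range_le hE (hcard.trans hcA).le).trans ?_
        exact sum_le_sum fun j _ => Nat.choose_le_choose _ (by omega)
    _ = ∑ j ∈ range ℓ, ∑ q ∈ range N', (c j - (τ (ℓ - 1) + q)).choose (j + 1) := sum_comm
    _ ≤ _ := sum_le_sum fun j _ => sum_range_choose_sub_le _ _ _ _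

/-! ### Ranks of spread sequences -/

/-- The code of a spread sequence read backwards and measured from the top of its range; it is the
cascade of `rank τ w`. -/
def coCode {n ℓ : ℕ} (τ : ℕ → ℕ) (w : Fin ℓ → Fin n) (k : ℕ) : ℕ :=
  if h : k < ℓ then
    n - 1 - w ⟨ℓ - 1 - k, by omega⟩ + k - ∑ r ∈ Ico (ℓ - 1 - k) (ℓ - 1), τ r
  else 0

/-- The rank of a spread sequence among the spread sequences of the same length: `rank τ w` is the
number of those that are lexicographically larger as sequences of indices, computed by the
combinatorial number system. -/
def rank {n ℓ : ℕ} (τ : ℕ → ℕ) (w : Fin ℓ → Fin n) : ℕ :=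
  ∑ k ∈ range ℓ, (coCode τ w k).choose (k + 1)

theorem IsSpreadSeq.coCode_add {n ℓ : ℕ} {τ : ℕ → ℕ} {w : Fin ℓ → Fin n} (h : IsSpreadSeq τ w)
    {k : ℕ} (hk : k < ℓ) :
    coCode τ w k + ∑ r ∈ Ico (ℓ - 1 - k) (ℓ - 1), τ r =
      n - 1 - w ⟨ℓ - 1 - k, by omega⟩ + k := by
  have h1 := h.add_sum_le (i := ℓ - 1 - k) (k := ℓ - 1) (by omega) (by omega)
  have h2 := (w ⟨ℓ - 1, by omega⟩).2
  rw [coCode, dif_pos hk]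
  omega

theorem IsSpreadSeq.coCode_strictMonoOn {n ℓ : ℕ} {τ : ℕ → ℕ} {w : Fin ℓ → Fin n}
    (h : IsSpreadSeq τ w) : StrictMonoOn (coCode τ w) (Set.Iio ℓ) := by
  intro x hx y hy hxy
  have hx' : x < ℓ := hx
  have hy' : y < ℓ := hy
  have h1 := h.coCode_add hx'
  have h2 := h.coCode_add hy'
  have h3 := h.add_sum_le (i := ℓ - 1 - y) (k := ℓ - 1 - x) (by omega) (by omega)
  have h4 := sum_Ico_consecutive τ (show ℓ - 1 - y ≤ ℓ - 1 - x by omega)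
    (show ℓ - 1 - x ≤ ℓ - 1 by omega)
  have h5 := (w ⟨ℓ - 1 - x, by omega⟩).2
  omega

theorem rank_le_rank {n ℓ : ℕ} (τ : ℕ → ℕ) {w w' : Fin ℓ → Fin n} (h : ∀ i, w' i ≤ w i) :
    rank τ w ≤ rank τ w' := by
  refine sum_le_sum fun k hk => Nat.choose_le_choose _ ?_
  rw [coCode, coCode, dif_pos (mem_range.1 hk), dif_pos (mem_range.1 hk)]
  have := Fin.le_def.1 (h ⟨ℓ - 1 - k, by have := mem_range.1 hk; omega⟩)
  omega

theorem eq_of_rank_eq {n ℓ : ℕ} {τ : ℕ → ℕ} {w w' : Fin ℓ → Fin n} (h : IsSpreadSeq τ w)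
    (h' : IsSpreadSeq τ w') (e : rank τ w = rank τ w') : w = w' := by
  have key := cascade_unique h.coCode_strictMonoOn h'.coCode_strictMonoOn e
  funext i
  have hi := i.2
  have h1 := h.coCode_add (k := ℓ - 1 - i) (by omega)
  have h2 := h'.coCode_add (k := ℓ - 1 - i) (by omega)
  rw [key _ (by omega)] at h1
  have e : (⟨ℓ - 1 - (ℓ - 1 - i), by omega⟩ : Fin ℓ) = i := Fin.ext (by dsimp only; omega)
  rw [e] at h1 h2
  have := (w i).2
  have := (w' i).2
  exact Fin.ext (by omega)

theorem IsSpreadSeq.coCode_init {n ℓ : ℕ} {τ : ℕ → ℕ} {w : Fin (ℓ + 1) → Fin n}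
    (h : IsSpreadSeq τ w) {k : ℕ} (hk : k < ℓ) :
    coCode τ (Fin.init w) k + 1 - τ (ℓ - 1) = coCode τ w (k + 1) := by
  have h1 := h.init.coCode_add hk
  have h2 := h.coCode_add (k := k + 1) (by omega)
  have e : (⟨ℓ + 1 - 1 - (k + 1), by omega⟩ : Fin (ℓ + 1)) =
      Fin.castSucc ⟨ℓ - 1 - k, by omega⟩ := Fin.ext (by simp; omega)
  rw [e, show ℓ + 1 - 1 - (k + 1) = ℓ - 1 - k by omega,
    show ℓ + 1 - 1 = ℓ - 1 + 1 by omega, sum_Ico_succ_top (by omega)] at h2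
  simp only [Fin.init] at h1 ⊢
  omega

theorem IsSpreadSeq.sum_shifted_coCode_init_le_rank {n ℓ : ℕ} {τ : ℕ → ℕ}
    {w : Fin (ℓ + 1) → Fin n} (h : IsSpreadSeq τ w) :
    ∑ k ∈ range ℓ, (coCode τ (Fin.init w) k + 1 - τ (ℓ - 1)).choose (k + 2) ≤ rank τ w := by
  rw [rank, sum_range_succ']
  refine (sum_le_sum fun k hk => ?_).trans (Nat.le_add_right _ _)
  rw [h.coCode_init (mem_range.1 hk)]

/-- Sequences of rank below `expansionShift ℓ (τ (ℓ - 1)) a` have initial parts of rank below `a`;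
this is the contrapositive. -/
theorem IsSpreadSeq.expansionShift_le_rank {n ℓ a : ℕ} {τ : ℕ → ℕ} (hℓ : 1 ≤ ℓ)
    {w : Fin (ℓ + 1) → Fin n} (h : IsSpreadSeq τ w) (ha : a ≤ rank τ (Fin.init w)) :
    expansionShift ℓ (τ (ℓ - 1)) a ≤ rank τ w := by
  obtain ⟨c, hc, rfl, hshift⟩ := exists_cascade ℓ a hℓ
  rw [hshift]
  exact (sum_shifted_cascade_mono hc h.init.coCode_strictMonoOn ha).trans
    h.sum_shifted_coCode_init_le_rank

/-- If the ranks below `a` are attained in length `ℓ`, then the ranks below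
`expansionShift ℓ (τ (ℓ - 1)) a` are attained in length `ℓ + 1`. -/
theorem exists_rank_eq_of_lt_expansionShift {n ℓ a r : ℕ} {τ : ℕ → ℕ} (hℓ : 1 ≤ ℓ)
    (ha : ∀ q < a, ∃ p : Fin ℓ → Fin n, IsSpreadSeq τ p ∧ rank τ p = q)
    (hr : r < expansionShift ℓ (τ (ℓ - 1)) a) :
    ∃ w : Fin (ℓ + 1) → Fin n, IsSpreadSeq τ w ∧ rank τ w = r := by
  obtain ⟨c, hc, hca, hshift⟩ := exists_cascade ℓ a hℓ
  obtain ⟨b, hb, hbr, -⟩ := exists_cascade (ℓ + 1) r (by omega)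
  have hpos : ∀ k < ℓ, 1 ≤ b (k + 1) := fun k hk =>
    Nat.one_le_of_lt (hb (show k < ℓ + 1 by omega) (show k + 1 < ℓ + 1 by omega)
      (Nat.lt_succ_self k))
  -- the cascade of the initial part of the required sequence
  have hmono : StrictMonoOn (fun k => b (k + 1) + τ (ℓ - 1) - 1) (Set.Iio ℓ) := by
    intro x hx y hy hxy
    simp only [Set.mem_Iio] at hx hy
    have := hb (show x + 1 < ℓ + 1 by omega) (show y + 1 < ℓ + 1 by omega)
      (Nat.add_lt_add_right hxy 1)
    have := hpos x hx
    dsimp only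
    omega
  have hlt : ∑ k ∈ range ℓ, (b (k + 1) + τ (ℓ - 1) - 1).choose (k + 1) < a := by
    by_contra! hcon
    rw [hca] at hcon
    have h1 := sum_shifted_cascade_mono (s := τ (ℓ - 1)) hc hmono hcon
    rw [← hshift] at h1
    have h2 : ∑ k ∈ range ℓ, (b (k + 1) + τ (ℓ - 1) - 1 + 1 - τ (ℓ - 1)).choose (k + 2) ≤ r := by
      rw [hbr, sum_range_succ']
      refine (sum_le_sum fun k hk => ?_).trans (Nat.le_add_right _ _)
      have := hpos k (mem_range.1 hk)
      exact Nat.choose_le_choose _ (by omega)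
    omega
  obtain ⟨p, hp, hpr⟩ := ha _ hlt
  have hpb := cascade_unique hp.coCode_strictMonoOn hmono hpr
  have h0 := hp.coCode_add (k := 0) (by omega)
  have h01 : b 0 < b 1 := hb (by simp) (show 1 < ℓ + 1 by omega) (by omega)
  have hp0 := (p ⟨ℓ - 1, by omega⟩).2
  rw [hpb 0 (by omega)] at h0
  simp only [Nat.sub_zero, Ico_self, sum_empty, add_zero, zero_add] at h0
  have hw : IsSpreadSeq τ (Fin.snoc p ⟨n - 1 - b 0, by omega⟩ : Fin (ℓ + 1) → Fin n) := by
    intro i hi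
    have e1 : (⟨i, by omega⟩ : Fin (ℓ + 1)) = Fin.castSucc ⟨i, by omega⟩ := rfl
    rw [e1, Fin.snoc_castSucc]
    rcases Nat.lt_or_ge (i + 1) ℓ with hi' | hi'
    · have e2 : (⟨i + 1, hi⟩ : Fin (ℓ + 1)) = Fin.castSucc ⟨i + 1, hi'⟩ := rfl
      rw [e2, Fin.snoc_castSucc]
      exact hp i hi'
    · obtain rfl : ℓ = i + 1 := by omega
      have e2 : (⟨i + 1, hi⟩ : Fin (i + 1 + 1)) = Fin.last (i + 1) := rfl
      rw [e2, Fin.snoc_last]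
      simp only [Nat.add_sub_cancel] at h0 hp0 ⊢
      omega
  refine ⟨_, hw, ?_⟩
  rw [rank, hbr]
  refine sum_congr rfl fun k hk => ?_
  rw [mem_range] at hk
  congr 1
  obtain _ | k := k
  · have h1 := hw.coCode_add (k := 0) (by omega)
    have e : (⟨ℓ + 1 - 1 - 0, by omega⟩ : Fin (ℓ + 1)) = Fin.last ℓ := rfl
    rw [e, Fin.snoc_last] at h1
    simp only [Nat.sub_zero, Ico_self, sum_empty, add_zero] at h1
    omega
  · rw [← hw.coCode_init (by omega), Fin.init_snoc, hpb k (by omega)]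
    have := hpos k (by omega)
    omega

/-! ### Spread monomials outside a strongly stable ideal -/

/-- The gap bounds `t` as a sequence, extended by zero. -/
def gaps {d : ℕ} (t : Fin (d - 1) → ℕ) (r : ℕ) : ℕ :=
  if h : r < d - 1 then t ⟨r, h⟩ else 0

theorem isSpread_iff {n d : ℕ} {t : Fin (d - 1) → ℕ} {u : Fin n →₀ ℕ} :
    IsSpread t u ↔
      ∃ ℓ ≤ d, ∃ w : Fin ℓ → Fin n, IsSpreadSeq (gaps t) w ∧ seqMonomial w = u := by
  constructor
  · rintro ⟨ℓ, hℓ, w, -, rfl, hw⟩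
    refine ⟨ℓ, hℓ, w, fun i hi => ?_, rfl⟩
    have hi' : i < d - 1 := by omega
    rw [gaps, dif_pos hi']
    exact hw ⟨i, hi'⟩ hi
  · rintro ⟨ℓ, hℓ, w, hw, rfl⟩
    refine ⟨ℓ, hℓ, w, hw.monotone, rfl, fun i hi => ?_⟩
    have := hw i hi
    rwa [gaps, dif_pos i.2] at this

theorem mem_spreadMonomials_iff {n d ℓ : ℕ} {t : Fin (d - 1) → ℕ} {u : Fin n →₀ ℕ} :
    u ∈ spreadMonomials n t ℓ ↔
      ℓ ≤ d ∧ ∃ w : Fin ℓ → Fin n, IsSpreadSeq (gaps t) w ∧ seqMonomial w = u := by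
  constructor
  · rintro ⟨hu, hdeg⟩
    obtain ⟨m, hm, w, hw, rfl⟩ := isSpread_iff.1 hu
    rw [degree_seqMonomial] at hdeg
    subst hdeg
    exact ⟨hm, w, hw, rfl⟩
  · rintro ⟨hℓ, w, hw, rfl⟩
    exact ⟨isSpread_iff.2 ⟨ℓ, hℓ, w, hw, rfl⟩, degree_seqMonomial w⟩

theorem fVector_apply {n d : ℕ} {K : Type*} [Field K] (t : Fin (d - 1) → ℕ)
    (I : Ideal (MvPolynomial (Fin n) K)) (ℓ : Fin (d + 1)) :
    fVector t I ℓ = {w : Fin ℓ → Fin n | IsSpreadSeq (gaps t) w ∧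
      MvPolynomial.monomial (seqMonomial w) (1 : K) ∉ I}.ncard := by
  have hfin := finite_spreadMonomials n t ℓ
  have hsub : spreadPart t I ℓ ⊆ spreadMonomials n t ℓ := fun _ hu => hu.1
  rw [fVector, ← Set.ncard_sdiff hsub (hfin.subset hsub)]
  have e : spreadMonomials n t ℓ \ spreadPart t I ℓ =
      seqMonomial '' {w : Fin ℓ → Fin n | IsSpreadSeq (gaps t) w ∧
        MvPolynomial.monomial (seqMonomial w) (1 : K) ∉ I} := by
    ext u
    simp only [Set.mem_sdiff, spreadPart, Set.mem_ofPred_eq, not_and, Set.mem_image]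
    constructor
    · rintro ⟨hu, huI⟩
      obtain ⟨-, w, hw, rfl⟩ := mem_spreadMonomials_iff.1 hu
      exact ⟨w, ⟨hw, huI hu⟩, rfl⟩
    · rintro ⟨w, ⟨hw, hwI⟩, rfl⟩
      exact ⟨mem_spreadMonomials_iff.2 ⟨by omega, w, hw, rfl⟩, fun _ => hwI⟩
  rw [e]
  exact Set.InjOn.ncard_image
    fun w hw w' hw' h => eq_of_seqMonomial_eq hw.1.monotone hw'.1.monotone h

theorem spreadOp_of_ne_zero (n : ℕ) {d : ℕ} (t : Fin (d - 1) → ℕ) {ℓ : Fin d}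
    (hℓ : (ℓ : ℕ) ≠ 0) (a : ℕ) :
    spreadOp n t ℓ a = expansionShift ℓ (gaps t (ℓ - 1)) a := by
  rw [spreadOp, dif_neg hℓ, gaps, dif_pos (by omega)]

/-- The growth condition for a strongly stable ideal. Raising an index of a spread monomial outside
the ideal gives a monomial outside the ideal, since strong stability would lower it back. -/
theorem IsStronglyStableIdeal.fVector_succ_le {n d : ℕ} {K : Type*} [Field K]
    {t : Fin (d - 1) → ℕ} {I : Ideal (MvPolynomial (Fin n) K)} (hI : IsStronglyStableIdeal t I)
    (ℓ : Fin d) (hℓ : (ℓ : ℕ) ≠ 0) :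
    fVector t I ℓ.succ ≤ expansionShift ℓ (gaps t (ℓ - 1)) (fVector t I ℓ.castSucc) := by
  classical
  rw [fVector_apply, fVector_apply, Set.ncard_eq_toFinset_card', Set.ncard_eq_toFinset_card']
  refine card_le_expansionShift (by omega) ?_ ?_ ?_ ?_
  · intro w hw
    exact (Set.mem_toFinset.1 hw).1
  · intro w hw i b hib hsp
    obtain ⟨hw, hwI⟩ := Set.mem_toFinset.1 hw
    refine Set.mem_toFinset.2 ⟨hsp, fun hmem => hwI ?_⟩
    have hℓd : (ℓ : ℕ) ≤ d := ℓ.2.le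
    have hupd := seqMonomial_update w i b
    have hb : seqMonomial (Function.update w i b) b ≠ 0 := by
      rw [seqMonomial_apply]
      exact (card_pos.2 ⟨i, by simp⟩).ne'
    have e : seqMonomial (Function.update w i b) - Finsupp.single b 1 + Finsupp.single (w i) 1 =
        seqMonomial w := by
      rw [tsub_add_eq_add_tsub (Finsupp.single_le_iff.2 (Nat.one_le_iff_ne_zero.2 hb)), hupd,
        add_tsub_cancel_right]
    have h1 := hI.2 ℓ _ ⟨mem_spreadMonomials_iff.2 ⟨hℓd, _, hsp, rfl⟩, hmem⟩ b (w i) hib hb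
    rw [e] at h1
    exact (h1 (isSpread_iff.2 ⟨ℓ, hℓd, w, hw, rfl⟩)).2
  · intro w hw
    exact (Set.mem_toFinset.1 hw).1
  · intro w hw
    obtain ⟨hw, hwI⟩ := Set.mem_toFinset.1 hw
    refine Set.mem_toFinset.2 ⟨hw.init, fun hmem => hwI ?_⟩
    rw [seqMonomial_succ, ← one_mul (1 : K), ← MvPolynomial.monomial_mul]
    exact I.mul_mem_right _ hmem

/-! ### The lexicographic ideal -/

/-- The exponent vectors of the spread monomials whose rank, in their degree `ℓ`, is at least `f ℓ`:
in each degree, all spread monomials except the `f ℓ` lexicographically last ones. -/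
def lexGenerators (n : ℕ) {d : ℕ} (t : Fin (d - 1) → ℕ) (f : Fin (d + 1) → ℕ) :
    Set (Fin n →₀ ℕ) :=
  {u | ∃ (ℓ : Fin (d + 1)) (w : Fin ℓ → Fin n), IsSpreadSeq (gaps t) w ∧ f ℓ ≤ rank (gaps t) w ∧
    seqMonomial w = u}

theorem monomial_mem_span_iff {n : ℕ} {K : Type*} [Field K] (A : Set (Fin n →₀ ℕ))
    (u : Fin n →₀ ℕ) :
    MvPolynomial.monomial u (1 : K) ∈
      Ideal.span ((fun u => MvPolynomial.monomial u (1 : K)) '' A) ↔ ∃ v ∈ A, v ≤ u := by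
  classical
  rw [MvPolynomial.mem_ideal_span_monomial_image, MvPolynomial.support_monomial,
    if_neg one_ne_zero]
  simp

/-- Under the growth condition on `f`, the ideal generated by the `lexGenerators` contains no other
spread monomials: a generator dividing a spread monomial is, entry by entry, at least an initial
part of it, and the growth condition carries membership from initial parts to the whole. -/
theorem monomial_mem_span_lexGenerators_iff {n d : ℕ} (K : Type*) [Field K]
    {t : Fin (d - 1) → ℕ} {f : Fin (d + 1) → ℕ} (h0 : f 0 = 1)
    (hf : ∀ ℓ : Fin d, f ℓ.succ ≤ spreadOp n t ℓ (f ℓ.castSucc)) (ℓ : Fin (d + 1))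
    {w : Fin ℓ → Fin n} (hw : IsSpreadSeq (gaps t) w) :
    MvPolynomial.monomial (seqMonomial w) (1 : K) ∈
      Ideal.span ((fun u => MvPolynomial.monomial u (1 : K)) '' lexGenerators n t f) ↔
      f ℓ ≤ rank (gaps t) w := by
  rw [monomial_mem_span_iff]
  refine ⟨?_, fun h => ⟨_, ⟨ℓ, w, hw, h, rfl⟩, le_rfl⟩⟩
  rintro ⟨_, ⟨m, v, hv, hfv, rfl⟩, hle⟩
  have hcomp := exists_le_of_sum_le hv.monotone hw.monotone fun x => sum_le_sum fun y _ => hle y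
  have hmℓ : (m : ℕ) ≤ ℓ := by
    by_contra! hlt
    obtain ⟨hi, -⟩ := hcomp ⟨ℓ, hlt⟩
    exact hi.false
  have hpre : ∀ (k : ℕ) (hk : k ≤ ℓ), IsSpreadSeq (gaps t) (w ∘ Fin.castLE hk) :=
    fun k hk i hi => hw i (hi.trans_le hk)
  have main : ∀ k, (m : ℕ) ≤ k → ∀ hk : k ≤ ℓ,
      f ⟨k, by omega⟩ ≤ rank (gaps t) (w ∘ Fin.castLE hk) := by
    intro k hmk
    induction k, hmk using Nat.le_induction with
    | base => exact fun hk => hfv.trans (rank_le_rank _ fun i => (hcomp i).2)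
    | succ k hmk ih =>
      intro hk
      have hprev := ih (by omega)
      obtain _ | k := k
      · have : f 0 ≤ 0 := hprev
        omega
      · have h1 := hf ⟨k + 1, by omega⟩
        rw [spreadOp_of_ne_zero n t (by simp)] at h1
        exact h1.trans (IsSpreadSeq.expansionShift_le_rank (ℓ := k + 1) (by simp)
          (hpre (k + 1 + 1) hk) hprev)
  exact main ℓ hmℓ le_rfl

/-- Under the growth condition on `f`, every number below `f ℓ` is the rank of a spread sequence of
length `ℓ`. In particular there are at least `f ℓ` spread monomials of degree `ℓ`. -/
theorem exists_rank_eq {n d : ℕ} {t : Fin (d - 1) → ℕ} {f : Fin (d + 1) → ℕ} (h0 : f 0 = 1)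
    (hf : ∀ ℓ : Fin d, f ℓ.succ ≤ spreadOp n t ℓ (f ℓ.castSucc)) (ℓ : Fin (d + 1)) :
    ∀ r < f ℓ, ∃ w : Fin ℓ → Fin n, IsSpreadSeq (gaps t) w ∧ rank (gaps t) w = r := by
  induction ℓ using Fin.induction with
  | zero =>
    intro r hr
    refine ⟨Fin.elim0, fun i hi => absurd hi (by simp), ?_⟩
    rw [h0] at hr
    simp only [rank, Fin.val_zero, range_zero, sum_empty]
    omega
  | succ ℓ ih =>
    intro r hr
    have hr' := hr.trans_le (hf ℓ)
    by_cases hℓ : (ℓ : ℕ) = 0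
    · obtain ⟨ℓ, hℓd⟩ := ℓ
      obtain rfl : ℓ = 0 := hℓ
      rw [show Fin.castSucc ⟨0, hℓd⟩ = (0 : Fin (d + 1)) from rfl, h0] at hr'
      have hrn : r < n := by simpa [spreadOp] using hr'
      refine ⟨fun _ => ⟨n - 1 - r, by omega⟩, fun i hi => ?_, ?_⟩
      · simp at hi
      · simp [rank, coCode]
        omega
    · rw [spreadOp_of_ne_zero n t hℓ] at hr'
      exact exists_rank_eq_of_lt_expansionShift (Nat.one_le_iff_ne_zero.2 hℓ) ih hr'

theorem isStronglyStableIdeal_span_lexGenerators {n d : ℕ} (K : Type*) [Field K]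
    {t : Fin (d - 1) → ℕ} {f : Fin (d + 1) → ℕ} (h0 : f 0 = 1)
    (hf : ∀ ℓ : Fin d, f ℓ.succ ≤ spreadOp n t ℓ (f ℓ.castSucc)) :
    IsStronglyStableIdeal t
      (Ideal.span ((fun u => MvPolynomial.monomial u (1 : K)) '' lexGenerators n t f)) := by
  refine ⟨⟨_, ?_, rfl⟩, ?_⟩
  · rintro _ ⟨ℓ, w, hw, -, rfl⟩
    exact isSpread_iff.2 ⟨ℓ, by omega, w, hw, rfl⟩
  · rintro ℓ u ⟨hu, huI⟩ i j hji hui hsp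
    have hadd : u - Finsupp.single i 1 + Finsupp.single j 1 + Finsupp.single i 1 =
        u + Finsupp.single j 1 := by
      rw [add_right_comm, tsub_add_cancel_of_le
        (Finsupp.single_le_iff.2 (Nat.one_le_iff_ne_zero.2 hui))]
    have hu' : u - Finsupp.single i 1 + Finsupp.single j 1 ∈ spreadMonomials n t ℓ := by
      refine ⟨hsp, ?_⟩
      have := congrArg Finsupp.degree hadd
      rw [map_add, map_add _ u, Finsupp.degree_single, Finsupp.degree_single, hu.2] at this
      exact Nat.add_right_cancel this
    refine ⟨hu', ?_⟩
    obtain ⟨hℓ, w, hw, rfl⟩ := mem_spreadMonomials_iff.1 hu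
    obtain ⟨-, w', hw', hww'⟩ := mem_spreadMonomials_iff.1 hu'
    rw [← hww'] at hadd ⊢
    rw [monomial_mem_span_lexGenerators_iff K h0 hf ⟨ℓ, by omega⟩ hw] at huI
    rw [monomial_mem_span_lexGenerators_iff K h0 hf ⟨ℓ, by omega⟩ hw']
    -- replacing `x_i` by `x_j` with `j < i` can only lower the entries of the sorted sequence
    refine huI.trans (rank_le_rank _ fun k => ?_)
    refine (exists_le_of_sum_le hw.monotone hw'.monotone (fun m => ?_) k).2
    have h1 : ∑ x ∈ Iic m, (seqMonomial w' x + Finsupp.single i 1 x) =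
        ∑ x ∈ Iic m, (seqMonomial w x + Finsupp.single j 1 x) :=
      sum_congr rfl fun x _ => DFunLike.congr_fun hadd x
    simp only [sum_add_distrib, Finsupp.single_apply, sum_ite_eq, mem_Iic] at h1
    have h2 : i ≤ m → j ≤ m := fun h => hji.le.trans h
    split_ifs at h1 <;> omega

theorem fVector_span_lexGenerators {n d : ℕ} (K : Type*) [Field K]
    {t : Fin (d - 1) → ℕ} {f : Fin (d + 1) → ℕ} (h0 : f 0 = 1)
    (hf : ∀ ℓ : Fin d, f ℓ.succ ≤ spreadOp n t ℓ (f ℓ.castSucc)) :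
    fVector t (Ideal.span ((fun u => MvPolynomial.monomial u (1 : K)) '' lexGenerators n t f)) =
      f := by
  funext ℓ
  rw [fVector_apply]
  have e : {w : Fin ℓ → Fin n | IsSpreadSeq (gaps t) w ∧
      MvPolynomial.monomial (seqMonomial w) (1 : K) ∉
        Ideal.span ((fun u => MvPolynomial.monomial u (1 : K)) '' lexGenerators n t f)} =
      {w | IsSpreadSeq (gaps t) w ∧ rank (gaps t) w < f ℓ} := by
    ext w
    refine and_congr_right fun hw => ?_
    rw [monomial_mem_span_lexGenerators_iff K h0 hf ℓ hw, not_le]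
  rw [e, ← Set.InjOn.ncard_image (f := rank (gaps t))
    fun w hw w' hw' h => eq_of_rank_eq hw.1 hw'.1 h]
  have e' : rank (gaps t) '' {w : Fin ℓ → Fin n | IsSpreadSeq (gaps t) w ∧
      rank (gaps t) w < f ℓ} = (range (f ℓ) : Finset ℕ) := by
    ext r
    simp only [Set.mem_image, Set.mem_ofPred_eq, coe_range, Set.mem_Iio]
    constructor
    · rintro ⟨w, ⟨-, hw⟩, rfl⟩
      exact hw
    · intro hr
      obtain ⟨w, hw, rfl⟩ := exists_rank_eq h0 hf ℓ r hr
      exact ⟨w, ⟨hw, hr⟩, rfl⟩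
  rw [e', Set.ncard_coe_finset, card_range]

theorem span_lexGenerators_ne_top {n d : ℕ} (K : Type*) [Field K]
    {t : Fin (d - 1) → ℕ} {f : Fin (d + 1) → ℕ} (h0 : f 0 = 1)
    (hf : ∀ ℓ : Fin d, f ℓ.succ ≤ spreadOp n t ℓ (f ℓ.castSucc)) :
    Ideal.span ((fun u => MvPolynomial.monomial u (1 : K)) '' lexGenerators n t f) ≠ ⊤ := by
  intro htop
  have h := (monomial_mem_span_lexGenerators_iff K h0 hf 0 (w := Fin.elim0)
    (fun i hi => absurd hi (by simp))).1 (htop ▸ Submodule.mem_top)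
  have : f 0 ≤ 0 := h
  omega

theorem fVector_zero {n d : ℕ} {K : Type*} [Field K] (t : Fin (d - 1) → ℕ)
    {I : Ideal (MvPolynomial (Fin n) K)} (hI : I ≠ ⊤) : fVector t I 0 = 1 := by
  rw [fVector_apply, Set.ncard_eq_one]
  refine ⟨Fin.elim0, Set.eq_singleton_iff_unique_mem.2 ⟨⟨fun i hi => absurd hi (by simp), ?_⟩,
    fun w _ => funext fun i => i.elim0⟩⟩
  intro h
  refine hI ((Ideal.eq_top_iff_one I).2 ?_)
  have e : seqMonomial (Fin.elim0 : Fin 0 → Fin n) = 0 := by simp [seqMonomial]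
  change MvPolynomial.monomial (seqMonomial (Fin.elim0 : Fin 0 → Fin n)) (1 : K) ∈ I at h
  rwa [e] at h

end VectorSpread

theorem mainTheorem1 (K : Type*) [Field K] (n d : ℕ) (hn : 1 ≤ n) (hd : 2 ≤ d)
    (t : Fin (d - 1) → ℕ) (f : Fin (d + 1) → ℕ) :
    (∃ I : Ideal (MvPolynomial (Fin n) K),
        I ≠ ⊤ ∧ VectorSpread.IsStronglyStableIdeal t I ∧ VectorSpread.fVector t I = f) ↔
      f 0 = 1 ∧
        ∀ ℓ : Fin d, f ℓ.succ ≤ VectorSpread.spreadOp n t ℓ (f ℓ.castSucc) := by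
  constructor
  · rintro ⟨I, hI, hstable, rfl⟩
    refine ⟨VectorSpread.fVector_zero t hI, fun ℓ => ?_⟩
    by_cases hℓ : (ℓ : ℕ) = 0
    · obtain ⟨ℓ, hℓd⟩ := ℓ
      obtain rfl : ℓ = 0 := hℓ
      rw [show Fin.castSucc ⟨0, hℓd⟩ = (0 : Fin (d + 1)) from rfl,
        VectorSpread.fVector_zero t hI, VectorSpread.fVector_apply]
      refine (Set.ncard_le_card _).trans ?_
      simp [VectorSpread.spreadOp]
    · rw [VectorSpread.spreadOp_of_ne_zero n t hℓ]
      exact hstable.fVector_succ_le ℓ hℓ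
  · rintro ⟨h0, hf⟩
    exact ⟨_, VectorSpread.span_lexGenerators_ne_top K h0 hf,
      VectorSpread.isStronglyStableIdeal_span_lexGenerators K h0 hf,
      VectorSpread.fVector_span_lexGenerators K h0 hf⟩
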